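/- Let $S_\infty$ be the group of all permutations of $\omega=\{0,1,2,\dots\}$ with the topology of pointwise convergence. For $m<\omega$ let $H_m$ be the set of injections from $m=\{0,\dots,m-1\}$ into $\omega$, and let $\beta H_m$ be the space of ultrafilters on $H_m$. The Samuel compactification $S(S_\infty)$ (for the left uniformity) is represented as the inverse limit $\varprojlim \beta H_n$ along the maps $\beta H_n\to\beta H_m$ ($m\le n$) extending the restriction maps $H_n\to H_m$, $x\mapsto x|_m$; write $\alpha(m)\in\beta H_m$ for the $m$-th coordinate of $\alpha\in S(S_\infty)$. For $\alpha\in S(S_\infty)$ and $f\in H_m$, let $\alpha\cdot f\in\beta H_m$ be the ultrafilter given by $S\in\alpha\cdot f\Leftrightarrow\{x\in H_n: x\circ f\in S\}\in\alpha(n)$, for any $n$ with $\operatorname{ran}(f)\subseteq n$ (the choice of $n$ does not matter). Then $S(S_\infty)$ is a semigroup under $$S\in(\alpha\gamma)(m)\iff\{f\in H_m: S\in\alpha\cdot f\}\in\gamma(m)\qquad(S\subseteq H_m).$$ A right ideal is a non-empty set $M\subseteq S(S_\infty)$ with $M\,S(S_\infty)\subseteq M$; it is minimal if it contains no other right ideal.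 Let $\mathrm{LO}(\omega)$ be the set of linear orders on $\omega$. For ${<_0},{<_1}\in\mathrm{LO}(\omega)$ let $A(<_0,<_1)\subseteq[\omega]^2$ be the set of those pairs $\{a,b\}$ on which $<_0$ and $<_1$ agree, i.e. $a<_0b\Leftrightarrow a<_1b$ and $b<_0a\Leftrightarrow b<_1a$. For a minimal right ideal $M$ let $A^M\subseteq\mathrm{LO}(\omega)\times\mathrm{LO}(\omega)$ consist of the pairs $(<_0,<_1)$ such that $\{s\in H_2:\{s(0),s(1)\}\in A(<_0,<_1)\}\in\alpha(2)$ for every $\alpha\in M$. **Theorem.** Let $M,N\subseteq S(S_\infty)$ be minimal right ideals. The following are equivalent. 1. $A^M=A^N$. 2. Whenever $u\in M$ and $v\in N$ are idempotents, $uv\in M$ is also idempotent. -/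

import Mathlib

namespace SamuelSInf

/-- `H m`: the injections from `m = {0, ..., m - 1}` into `ω`. Identified with the coset space
`S_∞ / (pointwise stabilizer of m)`. -/
abbrev H (m : ℕ) : Type := Fin m ↪ ℕ

/-- The dual map `H n → H m`, `x ↦ x ∘ e`, of an injection `e : m → n`. -/
def dual {m n : ℕ} (e : Fin m ↪ Fin n) (x : H n) : H m := e.trans x

/-- An injection `f : m → ω` whose range lies in `n`, as an injection `m → n`. -/
def cut {m : ℕ} (f : H m) (n : ℕ) (h : ∀ i, f i < n) : Fin m ↪ Fin n where
  toFun i := ⟨f i, h i⟩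
  inj' _ _ hij := f.injective (congrArg Fin.val hij)

/-- The least `n` such that the range of `f` lies in `n = {0, ..., n - 1}`. -/
def bound {m : ℕ} (f : H m) : ℕ := Finset.univ.sup fun i => f i + 1

theorem lt_bound {m : ℕ} (f : H m) (i : Fin m) : f i < bound f :=
  Finset.le_sup (f := fun i => f i + 1) (Finset.mem_univ i)

theorem bound_le {m : ℕ} {f : H m} {n : ℕ} (h : ∀ i, f i < n) : bound f ≤ n :=
  Finset.sup_le fun i _ => h i

/-- `S(S_∞)`, the Samuel compactification of the group `S_∞` of all permutations of `ω` (with its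
left uniformity): the inverse limit of the spaces `β (H n)` of ultrafilters along the maps
`β (H n) → β (H m)`, `m ≤ n`, which extend the restriction maps `H n → H m`. -/
@[ext]
structure SS where
  /-- The `n`-th projection to `β (H n)`. -/
  proj : ∀ n, Ultrafilter (H n)
  compat : ∀ {m n : ℕ} (h : m ≤ n), (proj n).map (dual (Fin.castLEEmb h)) = proj m

namespace SS

/-- `α · f`, for `α ∈ S(S_∞)` and `f ∈ H m`: the ultrafilter on `H m` with
`S ∈ α · f ↔ {x ∈ H n | x ∘ f ∈ S} ∈ α(n)`, where `n` is such that `f` maps into `n`. -/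
def act (α : SS) {m : ℕ} (f : H m) : Ultrafilter (H m) :=
  (α.proj (bound f)).map (dual (cut f (bound f) (lt_bound f)))

/-- The definition of `α · f` does not depend on the choice of `n`. -/
theorem act_eq (α : SS) {m : ℕ} (f : H m) (n : ℕ) (h : ∀ i, f i < n) :
    α.act f = (α.proj n).map (dual (cut f n h)) := by
  rw [act, ← α.compat (bound_le h), Ultrafilter.map_map]
  rfl

theorem mem_act (α : SS) {m : ℕ} (f : H m) (n : ℕ) (h : ∀ i, f i < n) (S : Set (H m)) :
    S ∈ α.act f ↔ {x : H n | dual (cut f n h) x ∈ S} ∈ α.proj n := by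
  rw [act_eq α f n h]; rfl

theorem act_dual (α : SS) {k m : ℕ} (f : H m) (e : Fin k ↪ Fin m) :
    α.act (dual e f) = (α.act f).map (dual e) := by
  rw [act_eq α (dual e f) (bound f) (fun i => lt_bound f (e i)), act, Ultrafilter.map_map]
  rfl

/-- The semigroup operation: `S ∈ (α γ)(m) ↔ {f ∈ H m | S ∈ α · f} ∈ γ(m)`. -/
instance : Mul SS where
  mul α γ :=
    { proj := fun m => (γ.proj m).bind fun f => α.act f
      compat := by
        intro m n h
        rw [← γ.compat h]
        ext S
        change {f : H n | dual (Fin.castLEEmb h) ⁻¹' S ∈ α.act f} ∈ γ.proj n ↔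
          {f : H n | S ∈ α.act (dual (Fin.castLEEmb h) f)} ∈ γ.proj n
        simp only [act_dual]
        rfl }

theorem mem_mul (α γ : SS) (m : ℕ) (S : Set (H m)) :
    S ∈ (α * γ).proj m ↔ {f : H m | S ∈ α.act f} ∈ γ.proj m := Iff.rfl

theorem mem_act_mul (α γ : SS) {m : ℕ} (f : H m) (S : Set (H m)) :
    S ∈ (α * γ).act f ↔ {x : H m | S ∈ α.act x} ∈ γ.act f := by
  rw [mem_act _ f _ (lt_bound f), mem_act _ f _ (lt_bound f), mem_mul]
  simp only [Set.mem_ofPred_eq, act_dual]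
  rfl

instance : Semigroup SS where
  mul_assoc α β γ := by
    ext m S
    simp only [mem_mul, mem_act_mul]

end SS

/-- A right ideal of a semigroup: a non-empty set `M` with `M S ⊆ M`. -/
def IsRightIdeal {S : Type*} [Semigroup S] (M : Set S) : Prop :=
  M.Nonempty ∧ ∀ x ∈ M, ∀ y : S, x * y ∈ M

/-- A right ideal that contains no other right ideal. -/
def IsMinimalRightIdeal {S : Type*} [Semigroup S] (M : Set S) : Prop :=
  IsRightIdeal M ∧ ∀ N : Set S, IsRightIdeal N → N ⊆ M → N = M

/-- `LO(ω)`: the (strict) linear orders on `ω`. -/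
structure LO where
  lt : ℕ → ℕ → Prop
  isStrictTotalOrder : IsStrictTotalOrder ℕ lt

/-- The filter `F_m^Y = {T ⊆ H m | T ∈ α(m) for all α ∈ Y}` on `H m`. -/
def filterAt (m : ℕ) (Y : Set SS) : Filter (H m) := ⨆ α ∈ Y, (α.proj m : Filter (H m))

theorem mem_filterAt {m : ℕ} {Y : Set SS} {T : Set (H m)} :
    T ∈ filterAt m Y ↔ ∀ α ∈ Y, T ∈ α.proj m := by
  simp [filterAt, Filter.mem_iSup]

/-- The order forgetful map `φ : H m → [ω]^m`, `(y_0, ..., y_{m-1}) ↦ {y_0, ..., y_{m-1}}`. -/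
def forget (m : ℕ) : H m → Set.powersetCard ℕ m := Set.powersetCard.ofFinEmb m ℕ

/-- `A(<₀, <₁) ⊆ [ω]^2`: the set of pairs on which the two linear orders agree. -/
def agreeSet (r₀ r₁ : LO) : Set (Set.powersetCard ℕ 2) :=
  {a | ∀ x ∈ a, ∀ y ∈ a, r₀.lt x y ↔ r₁.lt x y}

/-- `A^M = {(<₀, <₁) | A(<₀, <₁) ∈ φ(F_2^M)}`. -/
def agreeRel (M : Set SS) : Set (LO × LO) :=
  {p | agreeSet p.1 p.2 ∈ (filterAt 2 M).map (forget 2)}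

end SamuelSInf

/-!
An element `α` of `S(S_∞)` pulls a relation `r` on `ω` back to the relation `α.push r`, in which `i`
and `j` are related iff `r (x i) (x j)` for `α`-almost all `x`. This is a right action of the
semigroup (`SS.push_mul`) which preserves linear orders and commutes with reversal.

The Ramsey-theoretic input is one element: iterating a nonprincipal ultrafilter on `ω` gives
`SS.generic`, for which `generic · f` depends only on the order type of the tuple `f`
(`SS.orderInvariant_generic`). Order invariance passes to `α * generic`, so every right ideal
contains an order invariant `ε`. For such `ε` and a linear order `R`, the order `ε.push R` is the
usual order of `ω` or its reverse, and `ε * δ` is determined by how `δ` acts on the usual order.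
As `M = ε S(S_∞)` for minimal `M`, there are three consequences:

* two linear orders have either the same image under every element of `M`, or opposite images
  under every element of `M`, and `A^M` is the first case (`mem_agreeRel_iff`);
* an element of `M` is determined by its action on any one linear order (`eq_of_push_eq`);
* every linear order `R` is fixed by an idempotent of `M` (`exists_idempotent_push_eq`).

For idempotents `u ∈ M` and `v ∈ N` and a linear order `R` fixed by `u`, put `Q = v.push R`. Then
`u * v` sends `R` to `Q`, so it is idempotent iff it sends `Q` to `Q`. Since `u.push Q` is `R` or its
reverse, this happens iff `u.push Q = R`, that is, iff `(Q, R) ∈ A^M`; whereas `(Q, R) ∈ A^N` always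
holds, because `v.push Q = Q`. Both implications follow.
-/

namespace SamuelSInf

open Filter

namespace SS

/-! ### The action on relations -/

/-- The pull-back of a relation `r` on `ω` along `α`: the pair `(i, j)` is related iff
`r (x i) (x j)` holds for `α(n)`-almost all `x ∈ H n`, where `i, j < n`. -/
def push (α : SS) (r : ℕ → ℕ → Prop) (i j : ℕ) : Prop :=
  {x : H (max i j + 1) | r (x ⟨i, by omega⟩) (x ⟨j, by omega⟩)} ∈ α.proj (max i j + 1)

theorem push_iff (α : SS) (r : ℕ → ℕ → Prop) {i j n : ℕ} (hi : i < n) (hj : j < n) :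
    α.push r i j ↔ {x : H n | r (x ⟨i, hi⟩) (x ⟨j, hj⟩)} ∈ α.proj n := by
  rw [push, ← α.compat (show max i j + 1 ≤ n by omega)]
  rfl

theorem mem_act_iff_push (α : SS) (r : ℕ → ℕ → Prop) {m : ℕ} (f : H m) (a b : Fin m) :
    {x : H m | r (x a) (x b)} ∈ α.act f ↔ α.push r (f a) (f b) := by
  rw [push_iff α r (lt_bound f a) (lt_bound f b)]
  rfl

theorem push_mul (α γ : SS) (r : ℕ → ℕ → Prop) : (α * γ).push r = γ.push (α.push r) := by
  funext i j
  simp only [push, mem_mul, mem_act_iff_push]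

theorem push_swap (α : SS) (r : ℕ → ℕ → Prop) :
    α.push (Function.swap r) = Function.swap (α.push r) := by
  funext i j
  have hi : i < max i j + 1 := by omega
  have hj : j < max i j + 1 := by omega
  rw [Function.swap, push_iff α _ hi hj, push_iff α _ hj hi]

theorem isStrictTotalOrder_push (α : SS) (r : ℕ → ℕ → Prop) [IsStrictTotalOrder ℕ r] :
    IsStrictTotalOrder ℕ (α.push r) where
  irrefl i h := by
    obtain ⟨x, hx⟩ := Ultrafilter.nonempty_of_mem h
    exact irrefl_of r _ hx
  trans i j k hij hjk := by
    have hi : i < i + j + k + 1 := by omega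
    have hj : j < i + j + k + 1 := by omega
    have hk : k < i + j + k + 1 := by omega
    rw [push_iff α r hi hj] at hij
    rw [push_iff α r hj hk] at hjk
    rw [push_iff α r hi hk]
    filter_upwards [hij, hjk] with x h₁ h₂ using trans_of r h₁ h₂
  trichotomous i j hij hji := by
    have hi : i < max i j + 1 := by omega
    have hj : j < max i j + 1 := by omega
    rw [push_iff α r hi hj, ← Ultrafilter.compl_mem_iff_notMem] at hij
    rw [push_iff α r hj hi, ← Ultrafilter.compl_mem_iff_notMem] at hji
    obtain ⟨x, h₁, h₂⟩ := Ultrafilter.nonempty_of_mem (inter_mem hij hji)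
    have h := x.injective (Std.Trichotomous.trichotomous (r := r) _ _ h₁ h₂)
    exact congrArg Fin.val h

/-- The action of `S(S_∞)` on `LO(ω)`. -/
def pushLO (α : SS) (R : LO) : LO where
  lt := α.push R.lt
  isStrictTotalOrder := have := R.isStrictTotalOrder; α.isStrictTotalOrder_push R.lt

/-! ### Order invariant elements -/

/-- The tuple `x` followed by `a`. If `a` already occurs in `x`, a new value replaces it. -/
def extend {m : ℕ} (x : H m) (a : ℕ) : H (m + 1) :=
  open Classical in
  Fin.Embedding.snoc x (a := if a ∈ Set.range x then bound x else a) (by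
    split_ifs with h
    · rintro ⟨i, hi⟩
      exact (lt_bound x i).ne hi
    · exact h)

theorem extend_castSucc {m : ℕ} (x : H m) (a : ℕ) (i : Fin m) :
    extend x a i.castSucc = x i := by
  simp [extend]

theorem extend_last {m : ℕ} {x : H m} {a : ℕ} (h : a ∉ Set.range x) :
    extend x a (Fin.last m) = a := by
  simp only [extend, Fin.Embedding.snoc_last, if_neg h]

/-- The `m`-fold tensor power of a nonprincipal ultrafilter `U` on `ω`: a set `S` is a member iff
for `U`-almost all `x₀`, ..., for `U`-almost all `xₘ₋₁`, the tuple `x` is in `S`. -/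
noncomputable def genericProj : ∀ m, Ultrafilter (H m)
  | 0 => pure (Function.Embedding.ofIsEmpty)
  | m + 1 => (genericProj m).bind fun x => (hyperfilter ℕ).map (extend x)

theorem genericProj_compat {m n : ℕ} (h : m ≤ n) :
    (genericProj n).map (dual (Fin.castLEEmb h)) = genericProj m := by
  induction n, h using Nat.le_induction with
  | base => exact Ultrafilter.map_id _
  | succ n hmn ih =>
    rw [← ih]
    ext S
    change {x : H n | {a : ℕ | dual (Fin.castLEEmb _) (extend x a) ∈ S} ∈ hyperfilter ℕ} ∈
      genericProj n ↔ {x : H n | dual (Fin.castLEEmb hmn) x ∈ S} ∈ genericProj n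
    have key : ∀ (x : H n) (a : ℕ), dual (Fin.castLEEmb (Nat.le_succ_of_le hmn)) (extend x a) =
        dual (Fin.castLEEmb hmn) x := fun x a => by
      ext i
      exact extend_castSucc x a (Fin.castLE hmn i)
    have hconst : ∀ p : Prop, {_a : ℕ | p} ∈ hyperfilter ℕ ↔ p := fun p => by
      exact eventually_const (f := (hyperfilter ℕ : Filter ℕ)) (p := p)
    simp only [key, hconst]

/-- The element of `S(S_∞)` whose coordinates are the tensor powers of a nonprincipal
ultrafilter. -/
noncomputable def generic : SS := ⟨genericProj, genericProj_compat⟩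

theorem generic_act_of_strictMono {m : ℕ} (f : H m) (hf : StrictMono f) :
    generic.act f = generic.proj m := by
  induction m with
  | zero =>
    ext S
    rcases Set.eq_empty_or_nonempty S with rfl | hS
    · exact iff_of_false Ultrafilter.empty_notMem Ultrafilter.empty_notMem
    · rw [Set.Nonempty.eq_univ hS]
      exact iff_of_true univ_mem univ_mem
  | succ m ih =>
    set k := f (Fin.last m) with hk
    have hlt : ∀ i : Fin m, dual Fin.castSuccEmb f i < k := fun i => hf (Fin.castSucc_lt_last i)
    have hle : ∀ i, f i < k + 1 := fun i => Nat.lt_succ_of_le (hf.monotone (Fin.le_last i))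
    have ih' := ih (dual Fin.castSuccEmb f) (hf.comp Fin.strictMono_castSucc)
    rw [act_eq _ _ k hlt] at ih'
    have hrec : generic.proj (m + 1) =
        (generic.proj m).bind fun y => (hyperfilter ℕ).map (extend y) := rfl
    rw [act_eq _ f (k + 1) hle, hrec, ← ih']
    ext S
    change {x : H k | {a : ℕ | dual (cut f (k + 1) hle) (extend x a) ∈ S} ∈ hyperfilter ℕ} ∈
        generic.proj k ↔
      {x : H k | {a : ℕ | extend (dual (cut _ k hlt) x) a ∈ S} ∈ hyperfilter ℕ} ∈ generic.proj k
    have key : ∀ x : H k, ∀ᶠ a in hyperfilter ℕ,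
        dual (cut f (k + 1) hle) (extend x a) = extend (dual (cut _ k hlt) x) a := fun x => by
      filter_upwards [Set.Finite.compl_mem_hyperfilter (Set.finite_range x)] with a ha
      have ha' : a ∉ Set.range (dual (cut _ k hlt) x) := by
        rintro ⟨i, hi⟩
        exact ha ⟨_, hi⟩
      ext i
      induction i using Fin.lastCases with
      | last =>
        rw [extend_last ha']
        exact extend_last ha
      | cast i =>
        rw [extend_castSucc]
        exact extend_castSucc x a ⟨f i.castSucc, hlt i⟩
    have hset : {x : H k | {a : ℕ | dual (cut f (k + 1) hle) (extend x a) ∈ S} ∈ hyperfilter ℕ} =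
        {x : H k | {a : ℕ | extend (dual (cut _ k hlt) x) a ∈ S} ∈ hyperfilter ℕ} := by
      ext x
      exact eventually_congr ((key x).mono fun a h => by rw [h])
    rw [hset]

/-- `α` is order invariant if `α · f` depends only on the order type of the tuple `f`. -/
def OrderInvariant (α : SS) : Prop :=
  ∀ {m : ℕ} (f g : H m), (∀ i j, f i < f j ↔ g i < g j) → α.act f = α.act g

theorem orderInvariant_generic : OrderInvariant generic := by
  intro m f g hfg
  set σ := (Tuple.sort f).toEmbedding
  have hf : StrictMono (dual σ f) :=
    (Tuple.monotone_sort f).strictMono_of_injective (dual σ f).injective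
  have hg : StrictMono (dual σ g) := fun i j hij => (hfg _ _).1 (hf hij)
  have hσ : ∀ e : H m, e = dual (Tuple.sort f).symm.toEmbedding (dual σ e) := fun e => by
    ext i
    simp [dual, σ]
  rw [hσ f, hσ g, act_dual _ (dual σ f), act_dual _ (dual σ g), generic_act_of_strictMono _ hf,
    generic_act_of_strictMono _ hg]

theorem OrderInvariant.mul_left {γ : SS} (hγ : OrderInvariant γ) (α : SS) :
    OrderInvariant (α * γ) := by
  intro m f g hfg
  ext S
  rw [mem_act_mul, mem_act_mul, hγ f g hfg]

theorem OrderInvariant.push_congr {ε : SS} (hε : OrderInvariant ε) (r : ℕ → ℕ → Prop)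
    {i j k l : ℕ} (hij : i < j) (hkl : k < l) :
    (ε.push r i j ↔ ε.push r k l) ∧ (ε.push r j i ↔ ε.push r l k) := by
  let f : H 2 := ⟨![i, j], by simp [Function.Injective, Fin.forall_fin_two, hij.ne, hij.ne']⟩
  let g : H 2 := ⟨![k, l], by simp [Function.Injective, Fin.forall_fin_two, hkl.ne, hkl.ne']⟩
  have h : ε.act f = ε.act g := hε f g (by
    have hf : f 0 < f 1 := hij
    have hg : g 0 < g 1 := hkl
    simp [Fin.forall_fin_two, hf, hg, hf.asymm, hg.asymm])
  have h₁ := mem_act_iff_push ε r f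
  have h₂ := mem_act_iff_push ε r g
  rw [h] at h₁
  exact ⟨(h₁ 0 1).symm.trans (h₂ 0 1), (h₁ 1 0).symm.trans (h₂ 1 0)⟩

/-- An order invariant element sends a linear order to the usual order of `ω` or its reverse. -/
theorem OrderInvariant.push_eq {ε : SS} (hε : OrderInvariant ε) (r : ℕ → ℕ → Prop)
    [IsStrictTotalOrder ℕ r] :
    ε.push r = (· < ·) ∨ ε.push r = Function.swap (· < ·) := by
  have := ε.isStrictTotalOrder_push r
  have hasymm : ∀ i j, ε.push r i j → ¬ ε.push r j i := fun i j => asymm_of _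
  have htri : ∀ i j, ε.push r i j ∨ i = j ∨ ε.push r j i := fun i j => trichotomous_of _ i j
  have hc := fun {i j : ℕ} (h : i < j) => hε.push_congr r h Nat.zero_lt_one
  rcases htri 0 1 with h | h | h
  · left
    funext i j
    rcases lt_trichotomy i j with hij | rfl | hij
    · simpa [hij] using (hc hij).1.2 h
    · simpa using irrefl_of (ε.push r) i
    · exact propext (iff_of_false (hasymm _ _ ((hc hij).1.2 h)) hij.asymm)
  · exact absurd h zero_ne_one
  · right
    funext i j
    rcases lt_trichotomy i j with hij | rfl | hij
    · exact propext (iff_of_false (hasymm _ _ ((hc hij).2.2 h)) hij.asymm)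
    · simpa [Function.swap] using irrefl_of (ε.push r) i
    · simpa [hij, Function.swap] using (hc hij).2.2 h

/-- For order invariant `ε`, the product `ε * δ` is determined by the image of the usual order
under `δ`. -/
theorem OrderInvariant.mul_eq_mul {ε δ δ' : SS} (hε : OrderInvariant ε)
    (h : δ.push (· < ·) = δ'.push (· < ·)) : ε * δ = ε * δ' := by
  -- almost all tuples for `δ` have the order type prescribed by `δ.push (· < ·)`
  have htype : ∀ (γ : SS) (m : ℕ),
      {f : H m | ∀ i j : Fin m, f i < f j ↔ γ.push (· < ·) i j} ∈ γ.proj m := by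
    intro γ m
    change ∀ᶠ f : H m in γ.proj m, ∀ i j : Fin m, f i < f j ↔ γ.push (· < ·) i j
    rw [eventually_all]
    intro i
    rw [eventually_all]
    intro j
    have hp := γ.push_iff (· < ·) i.2 j.2
    by_cases hij : γ.push (· < ·) i j
    · filter_upwards [hp.1 hij] with f hf using iff_of_true hf hij
    · have hc := Ultrafilter.compl_mem_iff_notMem.2 (mt hp.2 hij)
      filter_upwards [hc] with f hf using iff_of_false hf hij
  ext m S
  obtain ⟨f₀, hf₀⟩ := Ultrafilter.nonempty_of_mem (htype δ m)
  have hconst : ∀ γ : SS, γ.push (· < ·) = δ.push (· < ·) →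
      (S ∈ (ε * γ).proj m ↔ S ∈ ε.act f₀) := by
    intro γ hγ
    rw [mem_mul]
    have hev : ∀ᶠ f : H m in γ.proj m, (S ∈ ε.act f ↔ S ∈ ε.act f₀) := by
      filter_upwards [htype γ m] with f hf
      rw [hε f f₀ fun i j => by rw [hf i j, hγ, hf₀ i j]]
    exact (eventually_congr hev).trans eventually_const
  rw [hconst δ rfl, hconst δ' h.symm]

/-! ### Limits of sequences of injections -/

/-- The limit in `S(S_∞)` of a sequence of injections `ω → ω` along a nonprincipal ultrafilter. -/
noncomputable def seqLim (g : ℕ → ℕ ↪ ℕ) : SS where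
  proj m := (hyperfilter ℕ).map fun n => Fin.valEmbedding.trans (g n)
  compat h := by
    rw [Ultrafilter.map_map]
    rfl

theorem seqLim_push (g : ℕ → ℕ ↪ ℕ) (r : ℕ → ℕ → Prop) (i j : ℕ) :
    (seqLim g).push r i j ↔ ∀ᶠ n in hyperfilter ℕ, r (g n i) (g n j) := Iff.rfl

/-- Every linear order on `ω` is the image of the usual order under some element of `S(S_∞)`: a
limit of injections which enumerate longer and longer finite parts increasingly. -/
theorem exists_push_lt_eq (r : ℕ → ℕ → Prop) [IsStrictTotalOrder ℕ r] :
    ∃ γ : SS, γ.push (· < ·) = r := by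
  classical
  -- the number of predecessors of `i` below `n`
  let c : ℕ → ℕ → ℕ := fun n i => ((Finset.range n).filter fun k => r k i).card
  have hc : ∀ {n i j : ℕ}, i < n → r i j → c n i < c n j := fun {n i j} hi hij => by
    refine Finset.card_lt_card (Finset.ssubset_iff_subset_ne.2 ⟨fun k hk => ?_, fun h => ?_⟩)
    · simp only [Finset.mem_filter] at hk ⊢
      exact ⟨hk.1, trans_of r hk.2 hij⟩
    · have : i ∈ (Finset.range n).filter fun k => r k i := by
        rw [h]
        simpa using ⟨hi, hij⟩
      simp only [Finset.mem_filter] at this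
      exact irrefl_of r i this.2
  have hcn : ∀ {n i : ℕ}, i < n → c n i < n := fun {n i} hi => by
    refine (Finset.card_lt_card (Finset.filter_ssubset.2 ⟨i, by simpa using hi, ?_⟩)).trans_eq
      (Finset.card_range n)
    exact irrefl_of r i
  have hinj : ∀ n, Function.Injective fun i => if i < n then c n i else i := fun n i j hij => by
    dsimp only at hij
    split_ifs at hij with hi hj hj
    · rcases trichotomous_of r i j with h | h | h
      · exact absurd hij (hc hi h).ne
      · exact h
      · exact absurd hij (hc hj h).ne'
    · exact absurd hij ((hcn hi).trans_le (not_lt.1 hj)).ne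
    · exact absurd hij ((hcn hj).trans_le (not_lt.1 hi)).ne'
    · exact hij
  refine ⟨seqLim fun n => ⟨_, hinj n⟩, ?_⟩
  funext i j
  rw [seqLim_push]
  have hev : ∀ᶠ n in (hyperfilter ℕ : Filter ℕ),
      ((if i < n then c n i else i) < (if j < n then c n j else j) ↔ r i j) := by
    have hlarge : ∀ᶠ n in (hyperfilter ℕ : Filter ℕ), max i j < n :=
      Nat.hyperfilter_le_atTop (eventually_gt_atTop _)
    filter_upwards [hlarge] with n hn
    have hi : i < n := (le_max_left _ _).trans_lt hn
    have hj : j < n := (le_max_right _ _).trans_lt hn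
    rw [if_pos hi, if_pos hj]
    refine ⟨fun h => ?_, hc hi⟩
    rcases trichotomous_of r i j with h' | rfl | h'
    · exact h'
    · exact absurd h (lt_irrefl _)
    · exact absurd h (hc hj h').asymm
  exact propext ((eventually_congr hev).trans eventually_const)

end SS

/-! ### Minimal right ideals -/

/-- A minimal right ideal is generated by each of its elements. -/
theorem IsMinimalRightIdeal.exists_mul_eq {S : Type*} [Semigroup S] {M : Set S}
    (hM : IsMinimalRightIdeal M) {a b : S} (ha : a ∈ M) (hb : b ∈ M) : ∃ c, a * c = b := by
  have h : Set.range (a * ·) = M := hM.2 _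
    ⟨⟨_, a, rfl⟩, by rintro _ ⟨c, rfl⟩ d; exact ⟨c * d, (mul_assoc _ _ _).symm⟩⟩
    (by rintro _ ⟨c, rfl⟩; exact hM.1.2 a ha c)
  rw [← h] at hb
  exact hb

theorem IsRightIdeal.exists_orderInvariant {M : Set SS} (hM : IsRightIdeal M) :
    ∃ ε ∈ M, ε.OrderInvariant := by
  obtain ⟨α, hα⟩ := hM.1
  exact ⟨α * SS.generic, hM.2 α hα _, SS.orderInvariant_generic.mul_left α⟩

theorem ne_swap_of_isStrictTotalOrder (r : ℕ → ℕ → Prop) [IsStrictTotalOrder ℕ r] :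
    r ≠ Function.swap r := fun h => by
  have h01 : r 0 1 = r 1 0 := congrFun (congrFun h 0) 1
  rcases trichotomous_of r 0 1 with h' | h' | h'
  · exact asymm_of r h' (h01 ▸ h')
  · exact zero_ne_one h'
  · exact asymm_of r h' (h01 ▸ h')

variable {M : Set SS}

/-- The elements of a minimal right ideal identify two given linear orders, or each of them sends
the two to opposite orders. -/
theorem forall_push_eq_or_swap (hM : IsMinimalRightIdeal M) (R₀ R₁ : LO) :
    (∀ α ∈ M, α.push R₀.lt = α.push R₁.lt) ∨
      ∀ α ∈ M, α.push R₀.lt = Function.swap (α.push R₁.lt) := by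
  obtain ⟨ε, hεM, hε⟩ := hM.1.exists_orderInvariant
  have := R₀.isStrictTotalOrder
  have := R₁.isStrictTotalOrder
  have h : ε.push R₀.lt = ε.push R₁.lt ∨ ε.push R₀.lt = Function.swap (ε.push R₁.lt) := by
    rcases hε.push_eq R₀.lt with h₀ | h₀ <;> rcases hε.push_eq R₁.lt with h₁ | h₁ <;>
      simp [h₀, h₁]
  refine h.imp (fun h α hα => ?_) fun h α hα => ?_ <;>
  · obtain ⟨δ, rfl⟩ := hM.exists_mul_eq hεM hα
    simp only [SS.push_mul, h, SS.push_swap]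

/-- Membership in `A^M` is membership in the first alternative of `forall_push_eq_or_swap`, and can
be tested on a single element of `M`. -/
theorem mem_agreeRel_iff (hM : IsMinimalRightIdeal M) {R₀ R₁ : LO} {α : SS} (hα : α ∈ M) :
    (R₀, R₁) ∈ agreeRel M ↔ α.push R₀.lt = α.push R₁.lt := by
  have := R₀.isStrictTotalOrder
  have := R₁.isStrictTotalOrder
  have hmem : (R₀, R₁) ∈ agreeRel M ↔ ∀ β ∈ M,
      {s : H 2 | (R₀.lt (s 0) (s 1) ↔ R₁.lt (s 0) (s 1)) ∧
        (R₀.lt (s 1) (s 0) ↔ R₁.lt (s 1) (s 0))} ∈ β.proj 2 := by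
    have hset : forget 2 ⁻¹' agreeSet R₀ R₁ =
        {s : H 2 | (R₀.lt (s 0) (s 1) ↔ R₁.lt (s 0) (s 1)) ∧
          (R₀.lt (s 1) (s 0) ↔ R₁.lt (s 1) (s 0))} := by
      ext s
      have hirr : ∀ i, R₀.lt i i ↔ R₁.lt i i := fun i =>
        iff_of_false (irrefl_of R₀.lt i) (irrefl_of R₁.lt i)
      simp only [forget, agreeSet, Set.mem_preimage, Set.mem_ofPred_eq,
        Set.powersetCard.mem_ofFinEmb_iff_mem_range, Set.forall_mem_range, Fin.forall_fin_two, hirr]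
      tauto
    change forget 2 ⁻¹' agreeSet R₀ R₁ ∈ filterAt 2 M ↔ _
    rw [mem_filterAt, hset]
  rcases forall_push_eq_or_swap hM R₀ R₁ with h | h
  · refine iff_of_true (hmem.2 fun β hβ => ?_) (h α hα)
    -- `β`-almost all pairs `s` are ordered by `R₀` as `0, 1` are by `β.push R₀`, likewise for `R₁`
    have key : ∀ i j : Fin 2,
        ∀ᶠ s : H 2 in β.proj 2, (R₀.lt (s i) (s j) ↔ R₁.lt (s i) (s j)) := fun i j => by
      have h₀ := β.push_iff R₀.lt i.2 j.2
      have h₁ := β.push_iff R₁.lt i.2 j.2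
      rw [h β hβ] at h₀
      by_cases hij : β.push R₁.lt i j
      · filter_upwards [h₀.1 hij, h₁.1 hij] with s hs₀ hs₁ using iff_of_true hs₀ hs₁
      · have hc₀ := Ultrafilter.compl_mem_iff_notMem.2 (mt h₀.2 hij)
        have hc₁ := Ultrafilter.compl_mem_iff_notMem.2 (mt h₁.2 hij)
        filter_upwards [hc₀, hc₁] with s hs₀ hs₁ using iff_of_false hs₀ hs₁
    exact (key 0 1).and (key 1 0)
  · have := α.isStrictTotalOrder_push R₁.lt
    refine iff_of_false (fun hA => ?_)
      fun he => ne_swap_of_isStrictTotalOrder _ (he.symm.trans (h α hα))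
    have hA := hmem.1 hA α hα
    have h2 : (0 : ℕ) < 2 := two_pos
    have h01 : α.push R₀.lt 0 1 ↔ α.push R₁.lt 0 1 := by
      rw [SS.push_iff α _ h2 one_lt_two, SS.push_iff α _ h2 one_lt_two]
      exact eventually_congr (Filter.mem_of_superset hA fun s hs => hs.1)
    rw [h α hα] at h01
    change α.push R₁.lt 1 0 ↔ _ at h01
    rcases trichotomous_of (α.push R₁.lt) 0 1 with h' | h' | h'
    · exact asymm_of (α.push R₁.lt) h' (h01.2 h')
    · exact zero_ne_one h'
    · exact asymm_of (α.push R₁.lt) h' (h01.1 h')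

/-- An element of a minimal right ideal is determined by its action on one linear order. -/
theorem eq_of_push_eq (hM : IsMinimalRightIdeal M) (R : LO) {α β : SS} (hα : α ∈ M) (hβ : β ∈ M)
    (h : α.push R.lt = β.push R.lt) : α = β := by
  obtain ⟨ε, hεM, hε⟩ := hM.1.exists_orderInvariant
  have := R.isStrictTotalOrder
  obtain ⟨δ, rfl⟩ := hM.exists_mul_eq hεM hα
  obtain ⟨δ', rfl⟩ := hM.exists_mul_eq hεM hβ
  rw [SS.push_mul, SS.push_mul] at h
  apply hε.mul_eq_mul
  rcases hε.push_eq R.lt with h' | h' <;> rw [h'] at h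
  · exact h
  · rw [SS.push_swap δ (· < ·), SS.push_swap δ' (· < ·)] at h
    exact congrArg Function.swap h

theorem isIdempotentElem_of_push (hM : IsMinimalRightIdeal M) (R : LO) {α : SS} (hα : α ∈ M)
    (h : α.push (α.push R.lt) = α.push R.lt) : IsIdempotentElem α :=
  eq_of_push_eq hM R (hM.1.2 α hα α) hα (by rw [SS.push_mul, h])

theorem push_push_of_isIdempotentElem {α : SS} (h : IsIdempotentElem α) (r : ℕ → ℕ → Prop) :
    α.push (α.push r) = α.push r := by
  rw [← SS.push_mul, h.eq]

theorem exists_idempotent_push_eq (hM : IsMinimalRightIdeal M) (R : LO) :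
    ∃ u ∈ M, IsIdempotentElem u ∧ u.push R.lt = R.lt := by
  obtain ⟨ε, hεM, hε⟩ := hM.1.exists_orderInvariant
  have := R.isStrictTotalOrder
  have hex : ∃ γ : SS, γ.push (ε.push R.lt) = R.lt := by
    rcases hε.push_eq R.lt with h | h
    · rw [h]
      exact SS.exists_push_lt_eq R.lt
    · have : IsStrictTotalOrder ℕ (Function.swap R.lt) := inferInstance
      obtain ⟨γ, hγ⟩ := SS.exists_push_lt_eq (Function.swap R.lt)
      refine ⟨γ, ?_⟩
      rw [h, SS.push_swap γ (· < ·), hγ]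
  obtain ⟨γ, hγ⟩ := hex
  have hfix : (ε * γ).push R.lt = R.lt := by rw [SS.push_mul, hγ]
  have hmem := hM.1.2 ε hεM γ
  exact ⟨ε * γ, hmem, isIdempotentElem_of_push hM R hmem (by rw [hfix, hfix]), hfix⟩

end SamuelSInf

open SamuelSInf in
theorem mainTheorem4 (M N : Set SamuelSInf.SS)
    (hM : SamuelSInf.IsMinimalRightIdeal M) (hN : SamuelSInf.IsMinimalRightIdeal N) :
    SamuelSInf.agreeRel M = SamuelSInf.agreeRel N ↔
      ∀ u ∈ M, ∀ v ∈ N, IsIdempotentElem u → IsIdempotentElem v →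
        u * v ∈ M ∧ IsIdempotentElem (u * v) := by
  let R₀ : LO := ⟨(· < ·), inferInstance⟩
  constructor
  · intro hA u hu v hv hu' hv'
    have huv := hM.1.2 u hu v
    refine ⟨huv, ?_⟩
    let R : LO := u.pushLO R₀
    have hR : u.push R.lt = R.lt := push_push_of_isIdempotentElem hu' _
    have hQ : (v.pushLO R, R) ∈ agreeRel N :=
      (mem_agreeRel_iff hN hv).2 (push_push_of_isIdempotentElem hv' _)
    rw [← hA, mem_agreeRel_iff hM hu, hR] at hQ
    change u.push (v.push R.lt) = R.lt at hQ
    refine isIdempotentElem_of_push hM R huv ?_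
    rw [SS.push_mul, SS.push_mul, hR, hQ]
  · intro h
    obtain ⟨v, hv, hv', -⟩ := exists_idempotent_push_eq hN R₀
    -- `v` moves linear orders only within their `A^M`-classes
    have key : ∀ (R : LO), ∀ α ∈ M, α.push (v.push R.lt) = α.push R.lt := by
      intro R α hα
      obtain ⟨u, hu, hu', hR⟩ := exists_idempotent_push_eq hM R
      have hid := push_push_of_isIdempotentElem (h u hu v hv hu' hv').2 R.lt
      simp only [SS.push_mul, hR] at hid
      rcases forall_push_eq_or_swap hM (v.pushLO R) R with h' | h'
      · exact h' α hα
      · have hu₁ : u.push (v.push R.lt) = Function.swap (u.push R.lt) := h' u hu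
        rw [hu₁, hR, SS.push_swap] at hid
        have := (v.pushLO R).isStrictTotalOrder
        exact absurd hid.symm (ne_swap_of_isStrictTotalOrder (v.pushLO R).lt)
    obtain ⟨u, hu⟩ := hM.1.1
    ext ⟨R₁, R₂⟩
    rw [mem_agreeRel_iff hM hu, mem_agreeRel_iff hN hv, ← key R₁ u hu, ← key R₂ u hu]
    rcases forall_push_eq_or_swap hN R₁ R₂ with h' | h'
    · simp [h' v hv]
    · have h₁ := h' v hv
      have := (v.pushLO R₂).isStrictTotalOrder
      have := (u.pushLO (v.pushLO R₂)).isStrictTotalOrder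
      rw [h₁, SS.push_swap]
      exact iff_of_false
        (fun h => ne_swap_of_isStrictTotalOrder (u.pushLO (v.pushLO R₂)).lt h.symm)
        (fun h => ne_swap_of_isStrictTotalOrder (v.pushLO R₂).lt h.symm)
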